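/- **Setting.** There are $m$ items and $n$ buyers. A valuation is a function $v:2^{[m]}\to\mathbb{R}_{\ge 0}$; it is *subadditive* if $v(\emptyset)=0$ and $v(S\cup T)\le v(S)+v(T)$ for all $S,T\subseteq[m]$. Buyer $i$ draws $v_i$ from a probability distribution $\mathcal{D}_i$, independently of the other buyers, and $\mathcal{D}=\mathcal{D}_1\times\cdots\times\mathcal{D}_n$. An item pricing is a vector $p\in[0,\infty]^m$ (price $\infty$ means "not for sale"), with $p(T)=\sum_{j\in T}p_j$. When the items of $S$ are offered at prices $p$, a buyer with valuation $v$ purchases a set $T\subseteq S$ that maximizes $v(T)-p(T)$ and that, among the maximizers, has maximal price; remaining ties are resolved by an arbitrary fixed (measurable) rule. For $S=[m]$ write $\mathrm{Alloc}(v,p)$ for the purchased set. *Ex ante item pricing revenue.* For $x\in\mathbb{R}_{\ge0}^m$ let $\mathrm{Rev}_x(\mathcal{D}_i)$ be the supremum of $\mathbb{E}_{p,\,v\sim\mathcal{D}_i}[p(\mathrm{Alloc}(v,p))]$ over all random item pricings $p$, independent of $v$, with $\Pr_{p,\,v\sim\mathcal{D}_i}[j\in\mathrm{Alloc}(v,p)]\le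 x_j$ for all $j\in[m]$. Let $$\mathrm{EARev}(\mathcal{D})=\sup\Big\{\sum_{i=1}^n\mathrm{Rev}_{x_i}(\mathcal{D}_i)\;:\;x_1,\dots,x_n\in\mathbb{R}^m_{\ge0},\ \sum_{i=1}^n x_{ij}\le1\ \text{for all } j\in[m]\Big\}.$$ *Sequential item pricing.* A sequential item pricing mechanism draws a random seed, independent of the valuations, and treats the buyers in the order $1,\dots,n$. It offers buyer $i$ the set $S_i$ of items not sold to buyers $1,\dots,i-1$ at item prices that may depend on the seed, on $S_i$ and on $v_1,\dots,v_{i-1}$; the buyer purchases as above and pays the price of the purchased set. Its revenue $\mathrm{Rev}(\mathcal{D},M)$ is the expected sum of the payments, and $\mathrm{Rev}(\mathcal{D},\mathrm{SeqItemPricing})=\sup_M\mathrm{Rev}(\mathcal{D},M)$. **Theorem.** There is an absolute constant $C>0$ such that for all $n$, $m$ and every product distribution $\mathcal{D}=\mathcal{D}_1\times\cdots\times\mathcal{D}_n$ over subadditive valuations on $m$ items, $$\mathrm{EARev}(\mathcal{D})\;\le\;C\log(m+1)\cdot\mathrm{Rev}(\mathcal{D},\mathrm{SeqItemPricing}),$$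 and moreover some sequential item pricing mechanism $M$ satisfies $\mathrm{EARev}(\mathcal{D})\le C\log(m+1)\cdot\mathrm{Rev}(\mathcal{D},M)$. (For $m\ge2$ the factor is $O(\log m)$.) -/

import Mathlib

open MeasureTheory
open scoped NNReal ENNReal

noncomputable section

namespace Pricing

/-- A combinatorial valuation: a nonnegative value for every bundle of the `m` items. -/
abbrev Valuation (m : ℕ) : Type := Finset (Fin m) → ℝ≥0

/-- Subadditive valuations, with the usual normalization that the empty bundle has value `0`. -/
def IsSubadditive {m : ℕ} (v : Valuation m) : Prop :=
  v ∅ = 0 ∧ ∀ S T : Finset (Fin m), v (S ∪ T) ≤ v S + v T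

/-- A (deterministic) item pricing. The price `∞` means that the item is not for sale. -/
abbrev ItemPrices (m : ℕ) : Type := Fin m → ℝ≥0∞

/-- Additive extension of an item pricing to bundles. -/
def price {m : ℕ} (p : ItemPrices m) (T : Finset (Fin m)) : ℝ≥0∞ := ∑ j ∈ T, p j

/-- Quasilinear utility `v(T) - p(T)`; it is `-∞` when `T` contains an item of price `∞`. -/
def util {m : ℕ} (v : Valuation m) (p : ItemPrices m) (T : Finset (Fin m)) : EReal :=
  ((v T : ℝ≥0∞) : EReal) - (price p T : EReal)

/-- `T` is a bundle that a buyer with valuation `v` may purchase when the items of `S` are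
available at prices `p`: it maximizes the utility among all bundles of available items and,
among all the maximizers, it has maximal price. -/
def IsFavorite {m : ℕ} (S : Finset (Fin m)) (p : ItemPrices m) (v : Valuation m)
    (T : Finset (Fin m)) : Prop :=
  T ⊆ S ∧ (∀ T' ⊆ S, util v p T' ≤ util v p T) ∧
    ∀ T' ⊆ S, util v p T' = util v p T → price p T' ≤ price p T

/-- A way in which buyers resolve the remaining ties: `alloc S p v` is the bundle purchased by a
buyer with valuation `v` when the items of `S` are offered at prices `p`. -/
structure TieBreaking (m : ℕ) where
  alloc : Finset (Fin m) → ItemPrices m → Valuation m → Finset (Fin m)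
  isFavorite : ∀ S p v, IsFavorite S p v (alloc S p v)
  measurable : ∀ S T, MeasurableSet {z : ItemPrices m × Valuation m | alloc S z.1 z.2 = T}

section ExAnte

variable {m : ℕ} (τ : TieBreaking m)

/-- The probability that a buyer with value distribution `D` purchases item `j` when all items
are offered at prices `p`. -/
def allocProb (D : Measure (Valuation m)) (p : ItemPrices m) (j : Fin m) : ℝ≥0∞ :=
  D {v | j ∈ τ.alloc Finset.univ p v}

/-- The expected revenue of the item pricing `p` from a buyer with value distribution `D`. -/
def revenue (D : Measure (Valuation m)) (p : ItemPrices m) : ℝ≥0∞ :=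
  ∫⁻ v, price p (τ.alloc Finset.univ p v) ∂D

/-- A random item pricing satisfies the ex ante constraint `x` over `D`. -/
def SatisfiesExAnte (D : Measure (Valuation m)) (x : Fin m → ℝ≥0)
    (P : ProbabilityMeasure (ItemPrices m)) : Prop :=
  ∀ j, ∫⁻ p, allocProb τ D p j ∂(P : Measure (ItemPrices m)) ≤ x j

/-- The optimal revenue of random item pricings from one buyer under the ex ante
constraint `x`. -/
def exAnteRevBuyer (D : Measure (Valuation m)) (x : Fin m → ℝ≥0) : ℝ≥0∞ :=
  ⨆ (P : ProbabilityMeasure (ItemPrices m)) (_ : SatisfiesExAnte τ D x P),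
    ∫⁻ p, revenue τ D p ∂(P : Measure (ItemPrices m))

/-- The optimal ex ante item pricing revenue from `n` independent buyers. -/
def EARev {n : ℕ} (D : Fin n → Measure (Valuation m)) : ℝ≥0∞ :=
  ⨆ (x : Fin n → Fin m → ℝ≥0) (_ : ∀ j, ∑ i, x i j ≤ 1), ∑ i, exAnteRevBuyer τ (D i) (x i)

end ExAnte

/-- A (randomized, adaptive) sequential item pricing mechanism for buyers arriving in the order
`0, 1, …, n - 1`. The mechanism draws a random seed, independently of the valuations. The prices
offered to buyer `i` depend on the seed, the valuations of the buyers before `i`, and the set of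
items that are still available. -/
structure SeqItemPricing (n m : ℕ) where
  Seed : Type
  [seedSpace : MeasurableSpace Seed]
  law : ProbabilityMeasure Seed
  offer : (i : Fin n) → Seed → (Set.Iio i → Valuation m) → Finset (Fin m) → ItemPrices m
  measurable_offer : ∀ i S,
    Measurable fun z : Seed × (Set.Iio i → Valuation m) => offer i z.1 z.2 S

attribute [instance] SeqItemPricing.seedSpace

namespace SeqItemPricing

variable {n m : ℕ} (M : SeqItemPricing n m) (τ : TieBreaking m)

/-- The prices offered to buyer `i` if the set `S` of items is available. -/
def prices (ω : M.Seed) (v : Fin n → Valuation m) (i : Fin n) (S : Finset (Fin m)) :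
    ItemPrices m :=
  M.offer i ω (fun k => v k.1) S

/-- The set of items that are left after the mechanism has interacted with the first `t`
buyers. -/
def available (ω : M.Seed) (v : Fin n → Valuation m) : ℕ → Finset (Fin m)
  | 0 => Finset.univ
  | t + 1 =>
    if h : t < n then
      available ω v t \
        τ.alloc (available ω v t) (M.prices ω v ⟨t, h⟩ (available ω v t)) (v ⟨t, h⟩)
    else available ω v t

/-- The payment of buyer `i`. -/
def payment (ω : M.Seed) (v : Fin n → Valuation m) (i : Fin n) : ℝ≥0∞ :=
  price (M.prices ω v i (M.available τ ω v i))
    (τ.alloc (M.available τ ω v i) (M.prices ω v i (M.available τ ω v i)) (v i))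

/-- The expected revenue, over the mechanism's seed and the independent valuations. -/
def rev (D : Fin n → Measure (Valuation m)) : ℝ≥0∞ :=
  ∫⁻ z, ∑ i, M.payment τ z.1 z.2 i ∂((M.law : Measure M.Seed).prod (Measure.pi D))

end SeqItemPricing

/-- The optimal revenue of sequential item pricing mechanisms. -/
def seqRev {n m : ℕ} (τ : TieBreaking m) (D : Fin n → Measure (Valuation m)) : ℝ≥0∞ :=
  ⨆ M : SeqItemPricing n m, M.rev τ D

end Pricing

end

/-!
At any available set of items, let each buyer face prices that are at least some floors `r`, and
suppose that these prices extract the amount `t i S` from buyer `i` when `S` is available. The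
floors turn the sold items into revenue, and monotonicity of `t i` turns the unsold ones into
revenue, so the mechanism collects a constant fraction of every quantity that is bounded by the sum
of the two for all `S`.

This applies to two parts of the ex ante revenue `R`. Payments of at least `4 m R` survive when all
prices are halved and then raised by the floor `R`: if the bundles `T` and `A` are demanded at the
prices `p` and `q`, then `p(T) + q(A) ≤ p(A) + q(T)`, which bounds the loss by a constant factor.
For smaller payments, discard the sales of item `j` below a floor `b j`, which cost at most `b j`
by the ex ante constraint. If `b j` is a quarter of the revenue from `j` plus `R / (4 m)`, then half
of the revenue remains, and the remaining prices lie within a factor `O(m ^ 2)` of the threshold.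
Scaling prices `p / 2, p, 2 p, …` through this range, the utility of a subadditive buyer drops from
at least half of the old payment to zero, while each doubling lowers it by at most the payment
collected at that scale. Hence one of `O(log m)` scales recovers the payment up to that factor, for
every set of available items.
-/

noncomputable section

namespace Pricing

section Demand

variable {m : ℕ} {S T A : Finset (Fin m)} {p q : ItemPrices m} {v : Valuation m}

theorem price_mono_set (p : ItemPrices m) (h : S ⊆ T) : price p S ≤ price p T :=
  Finset.sum_le_sum_of_subset h

theorem price_mono_prices (h : p ≤ q) (T : Finset (Fin m)) : price p T ≤ price q T :=
  Finset.sum_le_sum fun j _ => h j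

theorem price_smul (c : ℝ≥0∞) (p : ItemPrices m) (T : Finset (Fin m)) :
    price (c • p) T = c * price p T :=
  (Finset.mul_sum T p c).symm

theorem le_price_of_mem (p : ItemPrices m) {j : Fin m} (h : j ∈ T) : p j ≤ price p T :=
  Finset.single_le_sum (f := p) (fun _ _ => zero_le) h

theorem price_biUnion_le {ι : Type*} (p : ItemPrices m) (s : Finset ι)
    (T : ι → Finset (Fin m)) : price p (s.biUnion T) ≤ ∑ i ∈ s, price p (T i) := by
  classical
  induction s using Finset.induction_on with
  | empty => simp [price]
  | insert i s hi ih =>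
    rw [Finset.biUnion_insert, Finset.sum_insert hi]
    calc price p (T i ∪ s.biUnion T) ≤ price p (T i) + price p (s.biUnion T) :=
          le_self_add.trans_eq Finset.sum_union_inter
      _ ≤ price p (T i) + ∑ i ∈ s, price p (T i) := by gcongr

/-- `T` maximizes the utility of a buyer with valuation `v` among the bundles of items of `S` at
prices `p`. Unlike in `IsFavorite`, the choice among the maximizers is unconstrained. -/
def IsDemanded (S : Finset (Fin m)) (p : ItemPrices m) (v : Valuation m)
    (T : Finset (Fin m)) : Prop :=
  T ⊆ S ∧ ∀ T' ⊆ S, util v p T' ≤ util v p T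

theorem TieBreaking.isDemanded (τ : TieBreaking m) (S : Finset (Fin m)) (p : ItemPrices m)
    (v : Valuation m) : IsDemanded S p v (τ.alloc S p v) :=
  ⟨(τ.isFavorite S p v).1, (τ.isFavorite S p v).2.1⟩

namespace IsDemanded

theorem price_ne_top (h : IsDemanded S p v T) : price p T ≠ ∞ := by
  intro htop
  have h_empty := h.2 ∅ (Finset.empty_subset S)
  rw [util, util, htop, EReal.coe_ennreal_top, EReal.sub_top, le_bot_iff] at h_empty
  simp only [price, Finset.sum_empty, EReal.coe_ennreal_zero, sub_zero] at h_empty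
  exact EReal.coe_ennreal_ne_bot _ h_empty

theorem notMem_of_eq_top (h : IsDemanded S p v T) {j : Fin m} (hj : p j = ∞) : j ∉ T :=
  fun hjT => h.price_ne_top (top_le_iff.1 (hj.ge.trans (le_price_of_mem p hjT)))

theorem value_add_price_le (h : IsDemanded S p v T) (hA : A ⊆ S) :
    (v A : ℝ≥0∞) + price p T ≤ v T + price p A := by
  by_cases hA_top : price p A = ∞
  · simp [hA_top]
  have hutil := h.2 A hA
  have hT_top := h.price_ne_top
  unfold util at hutil
  lift price p T to ℝ≥0 using hT_top with t
  lift price p A to ℝ≥0 using hA_top with a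
  have hreal : (v A : ℝ) - a ≤ v T - t := by
    rw [← EReal.coe_le_coe_iff, EReal.coe_sub, EReal.coe_sub]
    exact hutil
  norm_cast
  rw [← NNReal.coe_le_coe]
  push_cast
  linarith

theorem price_le_value (h : IsDemanded S p v T) : price p T ≤ v T := by
  simpa [price] using le_add_self.trans (h.value_add_price_le (Finset.empty_subset S))

theorem law_of_demand (hT : IsDemanded S p v T) (hA : IsDemanded S q v A) :
    price p T + price q A ≤ price p A + price q T := by
  have hfin : (v A + v T : ℝ≥0∞) ≠ ∞ := by simp
  rw [← ENNReal.add_le_add_iff_left hfin]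
  calc (v A + v T + (price p T + price q A) : ℝ≥0∞)
      = (v A + price p T) + (v T + price q A) := by ring
    _ ≤ (v T + price p A) + (v A + price q T) :=
        add_le_add (hT.value_add_price_le hA.1) (hA.value_add_price_le hT.1)
    _ = v A + v T + (price p A + price q T) := by ring

theorem price_le_four_mul_price (hT : IsDemanded S p v T) (hA : IsDemanded S q v A)
    (hpq : p ≤ (2 : ℝ≥0∞) • q) (hqT : 4 * price q T ≤ 3 * price p T) :
    price p T ≤ 4 * price q A := by
  have hpA : price p A ≤ 2 * price q A := (price_mono_prices hpq A).trans_eq (price_smul _ _ _)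
  have hfin : 3 * price p T + 4 * price q A ≠ ∞ := by
    finiteness [hT.price_ne_top, hA.price_ne_top]
  rw [← ENNReal.add_le_add_iff_left hfin]
  calc 3 * price p T + 4 * price q A + price p T
      = 4 * (price p T + price q A) := by ring
    _ ≤ 4 * (price p A + price q T) := by gcongr 4 * ?_; exact hT.law_of_demand hA
    _ ≤ 4 * (2 * price q A) + 3 * price p T := by rw [mul_add]; gcongr
    _ = 3 * price p T + 4 * price q A + 4 * price q A := by ring

theorem price_le_value_of_subset (h : IsDemanded S p v T) (hv : IsSubadditive v) (hA : A ⊆ T) :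
    price p A ≤ v A := by
  have hrest : (v (T \ A) : ℝ≥0∞) + price p T ≤ v T + price p (T \ A) :=
    h.value_add_price_le (Finset.sdiff_subset.trans h.1)
  have hsub : (v T : ℝ≥0∞) ≤ v (T \ A) + v A := by
    have := hv.2 (T \ A) A
    rw [Finset.sdiff_union_of_subset hA] at this
    exact_mod_cast this
  have hsplit : price p (T \ A) + price p A = price p T := Finset.sum_sdiff hA
  have hfin : v (T \ A) + price p (T \ A) ≠ ∞ := by
    refine ENNReal.add_ne_top.2 ⟨ENNReal.coe_ne_top, ne_top_of_le_ne_top h.price_ne_top ?_⟩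
    exact price_mono_set p Finset.sdiff_subset
  rw [← ENNReal.add_le_add_iff_left hfin]
  calc v (T \ A) + price p (T \ A) + price p A = v (T \ A) + price p T := by
        rw [add_assoc, hsplit]
    _ ≤ v T + price p (T \ A) := hrest
    _ ≤ (v (T \ A) + v A) + price p (T \ A) := by gcongr
    _ = v (T \ A) + price p (T \ A) + v A := add_right_comm _ _ _

end IsDemanded

/-- The maximal utility of a buyer with valuation `v` when the items of `S` are offered at prices
`p`. Truncating the utility of each bundle at `0` is harmless since the empty bundle is free. -/
def indirectUtility (v : Valuation m) (S : Finset (Fin m)) (p : ItemPrices m) : ℝ≥0∞ :=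
  ⨆ (T : Finset (Fin m)) (_ : T ⊆ S), (v T : ℝ≥0∞) - price p T

theorem value_le_indirectUtility_add_price (v : Valuation m) (p : ItemPrices m) (h : T ⊆ S) :
    v T ≤ indirectUtility v S p + price p T :=
  tsub_le_iff_right.1 <| le_iSup₂ (f := fun T (_ : T ⊆ S) => (v T : ℝ≥0∞) - price p T) T h

namespace IsDemanded

theorem indirectUtility_add_price (h : IsDemanded S p v T) :
    indirectUtility v S p + price p T = v T := by
  have hle : indirectUtility v S p ≤ v T - price p T := by
    refine iSup₂_le fun A hA => tsub_le_iff_right.2 ?_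
    rw [← ENNReal.add_le_add_iff_right h.price_ne_top, add_right_comm,
      tsub_add_cancel_of_le h.price_le_value]
    exact h.value_add_price_le hA
  refine le_antisymm ?_ (value_le_indirectUtility_add_price v p h.1)
  calc indirectUtility v S p + price p T ≤ v T - price p T + price p T := by gcongr
    _ = v T := tsub_add_cancel_of_le h.price_le_value

theorem indirectUtility_le (h : IsDemanded S p v T) (hq : q ≤ (2 : ℝ≥0∞) • p) :
    indirectUtility v S p ≤ price p T + indirectUtility v S q := by
  rw [← ENNReal.add_le_add_iff_right h.price_ne_top]
  calc indirectUtility v S p + price p T = v T := h.indirectUtility_add_price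
    _ ≤ indirectUtility v S q + price q T := value_le_indirectUtility_add_price v q h.1
    _ ≤ indirectUtility v S q + 2 * price p T := by
        gcongr
        exact (price_mono_prices hq T).trans_eq (price_smul _ _ _)
    _ = price p T + indirectUtility v S q + price p T := by ring

theorem half_price_le_indirectUtility {S' : Finset (Fin m)} (h : IsDemanded S' p v T)
    (hv : IsSubadditive v) (hAT : A ⊆ T) (hAS : A ⊆ S) (hq : price q A ≤ 2⁻¹ * price p A) :
    2⁻¹ * price p A ≤ indirectUtility v S q := by
  have hfin : 2⁻¹ * price p A ≠ ∞ :=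
    ENNReal.mul_ne_top (by simp) (ne_top_of_le_ne_top h.price_ne_top (price_mono_set p hAT))
  rw [← ENNReal.add_le_add_iff_right hfin]
  calc 2⁻¹ * price p A + 2⁻¹ * price p A = price p A := by
        rw [← add_mul, ENNReal.inv_two_add_inv_two, one_mul]
    _ ≤ v A := h.price_le_value_of_subset hv hAT
    _ ≤ indirectUtility v S q + price q A := value_le_indirectUtility_add_price v q hAS
    _ ≤ indirectUtility v S q + 2⁻¹ * price p A := by gcongr

end IsDemanded

theorem indirectUtility_le_sum_price {q : ℕ → ItemPrices m} {A : ℕ → Finset (Fin m)}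
    (hA : ∀ k, IsDemanded S (q k) v (A k)) (hq : ∀ k, q (k + 1) ≤ (2 : ℝ≥0∞) • q k) (K : ℕ) :
    indirectUtility v S (q 0) ≤
      ∑ k ∈ Finset.range K, price (q k) (A k) + indirectUtility v S (q K) := by
  induction K with
  | zero => simp
  | succ K ih =>
    rw [Finset.sum_range_succ, add_assoc]
    exact ih.trans (by gcongr; exact (hA K).indirectUtility_le (hq K))

/-- The prices `p` on the items of `G`; the other items are not for sale. -/
def restrictPrices (G : Finset (Fin m)) (p : ItemPrices m) : ItemPrices m :=
  fun j => if j ∈ G then p j else ∞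

/-- The prices `p / 2, p, 2 p, 4 p, …` on the items of `G`; the other items are not for sale. -/
def scaledPrices (G : Finset (Fin m)) (p : ItemPrices m) (k : ℕ) : ItemPrices m :=
  restrictPrices G ((2 ^ k * 2⁻¹ : ℝ≥0∞) • p)

variable {G : Finset (Fin m)}

theorem price_restrictPrices (h : T ⊆ G) (p : ItemPrices m) :
    price (restrictPrices G p) T = price p T :=
  Finset.sum_congr rfl fun _ hj => if_pos (h hj)

theorem price_scaledPrices (h : T ⊆ G) (p : ItemPrices m) (k : ℕ) :
    price (scaledPrices G p k) T = 2 ^ k * 2⁻¹ * price p T := by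
  rw [scaledPrices, price_restrictPrices h, price_smul]

theorem IsDemanded.subset_of_restrictPrices (h : IsDemanded S (restrictPrices G p) v T) :
    T ⊆ G := by
  intro j hj
  by_contra hG
  exact h.notMem_of_eq_top (if_neg hG) hj

theorem scaledPrices_succ_le (G : Finset (Fin m)) (p : ItemPrices m) (k : ℕ) :
    scaledPrices G p (k + 1) ≤ (2 : ℝ≥0∞) • scaledPrices G p k := by
  intro j
  by_cases hj : j ∈ G
  · simp [scaledPrices, restrictPrices, hj, pow_succ', mul_assoc]
  · simp [scaledPrices, restrictPrices, hj, ENNReal.mul_top]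

/-- If the demand at the largest scale is empty, then raising the prices from `p / 2` to that scale
destroys all of the utility that the buyer has at the prices `p / 2`. Otherwise a single item at the
largest scale is already expensive enough. -/
theorem IsDemanded.price_inter_le_sum_scaledPrices {S' : Finset (Fin m)}
    (h : IsDemanded S' p v T) (hv : IsSubadditive v) (hG : G ⊆ S) {l : ℝ≥0∞} {K : ℕ}
    (hl : ∀ j ∈ G, l ≤ p j) (hK : price p T ≤ 2 ^ K * l) {A : ℕ → Finset (Fin m)}
    (hA : ∀ k, IsDemanded S (scaledPrices G p k) v (A k)) :
    price p (T ∩ G) ≤ 2 * ∑ k ∈ Finset.range (K + 1), price (scaledPrices G p k) (A k) := by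
  have hAG : A K ⊆ G := (hA K).subset_of_restrictPrices
  rw [Finset.sum_range_succ]
  rcases (A K).eq_empty_or_nonempty with h_empty | ⟨j, hj⟩
  · have h_last : indirectUtility v S (scaledPrices G p K) = 0 := by
      have := (hA K).indirectUtility_add_price
      simpa [h_empty, hv.1, price] using this
    have h_half : 2⁻¹ * price p (T ∩ G) ≤ indirectUtility v S (scaledPrices G p 0) := by
      refine h.half_price_le_indirectUtility hv Finset.inter_subset_left
        (Finset.inter_subset_right.trans hG) ?_
      rw [price_scaledPrices Finset.inter_subset_right, pow_zero, one_mul]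
    have h_sum := indirectUtility_le_sum_price hA (scaledPrices_succ_le G p) K
    rw [h_last, add_zero] at h_sum
    calc price p (T ∩ G) = 2 * (2⁻¹ * price p (T ∩ G)) := by
          rw [ENNReal.mul_inv_cancel_left two_ne_zero ENNReal.ofNat_ne_top]
      _ ≤ _ := by
          gcongr
          exact h_half.trans (h_sum.trans le_self_add)
  · calc price p (T ∩ G) ≤ price p T := price_mono_set p Finset.inter_subset_left
      _ ≤ 2 ^ K * l := hK
      _ ≤ 2 ^ K * price p (A K) := by
          gcongr
          exact (hl j (hAG hj)).trans (le_price_of_mem p hj)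
      _ = 2 * price (scaledPrices G p K) (A K) := by
          rw [price_scaledPrices hAG, ← mul_assoc, mul_left_comm,
            ENNReal.mul_inv_cancel two_ne_zero ENNReal.ofNat_ne_top, mul_one]
      _ ≤ _ := by
          gcongr
          exact le_add_self

end Demand

section Integration

theorem measurable_comp_of_countable {α β ι : Type*} [MeasurableSpace α] [MeasurableSpace β]
    [MeasurableSpace ι] [Countable ι] [MeasurableSingletonClass ι] {g : α → ι}
    (hg : Measurable g) {f : ι → α → β} (hf : ∀ i, Measurable (f i)) :
    Measurable fun a => f (g a) a :=
  (measurable_from_prod_countable_right (f := fun z : ι × α => f z.1 z.2) hf).comp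
    (hg.prodMk measurable_id)

theorem exists_lintegral_prod_le {α β : Type*} [MeasurableSpace α] [MeasurableSpace β]
    {μ : Measure α} {ν : Measure β} [IsProbabilityMeasure μ] [SFinite ν] {f : α × β → ℝ≥0∞}
    (hf : Measurable f) (hfin : ∫⁻ z, f z ∂μ.prod ν ≠ ∞) :
    ∃ x, ∫⁻ z, f z ∂μ.prod ν ≤ ∫⁻ y, f (x, y) ∂ν := by
  rw [lintegral_prod f hf.aemeasurable] at hfin ⊢
  exact exists_lintegral_le hfin

theorem lintegral_pi_eq_lintegral_update {ι : Type*} [Fintype ι] [DecidableEq ι] {X : ι → Type*}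
    [∀ i, MeasurableSpace (X i)] (μ : ∀ i, Measure (X i)) [∀ i, IsProbabilityMeasure (μ i)]
    (i : ι) {f : (∀ i, X i) → ℝ≥0∞} (hf : Measurable f) :
    ∫⁻ x, f x ∂Measure.pi μ = ∫⁻ x, ∫⁻ y, f (Function.update x i y) ∂μ i ∂Measure.pi μ := by
  have : ∀ i, Nonempty (X i) := fun i => nonempty_of_isProbabilityMeasure (μ i)
  obtain ⟨x⟩ : Nonempty (∀ i, X i) := inferInstance
  have hg : Measurable fun x => ∫⁻ y, f (Function.update x i y) ∂μ i :=
    (hf.comp measurable_update').lintegral_prod_right'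
  rw [lintegral_eq_lmarginal_univ x, lintegral_eq_lmarginal_univ x,
    lmarginal_erase' f hf (Finset.mem_univ i), lmarginal_erase' _ hg (Finset.mem_univ i)]
  simp only [Function.update_idem, lintegral_const, measure_univ, mul_one]

theorem sum_iSup_le {ι : Type*} [Fintype ι] {κ : ι → Type*} [∀ i, Nonempty (κ i)]
    {f : ∀ i, κ i → ℝ≥0∞} {B : ℝ≥0∞} (h : ∀ a : ∀ i, κ i, ∑ i, f i (a i) ≤ B) :
    ∑ i, ⨆ k, f i k ≤ B := by
  classical
  have h_eval : ∀ i, ⨆ k, f i k = ⨆ a : ∀ i, κ i, f i (a i) := fun i =>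
    ((Function.surjective_eval i).iSup_comp (f i)).symm
  simp only [h_eval]
  rw [ENNReal.finsetSum_iSup]
  · exact iSup_le h
  · intro a b
    refine ⟨fun i => if f i (a i) ≤ f i (b i) then b i else a i, fun i => ?_⟩
    by_cases hi : f i (a i) ≤ f i (b i)
    · simp [hi]
    · simp [hi, (not_le.1 hi).le]

end Integration

section Revenue

variable {m : ℕ} (τ : TieBreaking m)

theorem TieBreaking.measurable_alloc (S : Finset (Fin m)) :
    Measurable fun z : ItemPrices m × Valuation m => τ.alloc S z.1 z.2 :=
  measurable_to_countable' fun T => τ.measurable S T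

theorem measurable_price (T : Finset (Fin m)) : Measurable fun p : ItemPrices m => price p T :=
  Finset.measurable_fun_sum _ fun j _ => measurable_pi_apply j

theorem TieBreaking.measurable_price_alloc (S : Finset (Fin m)) :
    Measurable fun z : ItemPrices m × Valuation m => price z.1 (τ.alloc S z.1 z.2) :=
  measurable_comp_of_countable (τ.measurable_alloc S)
    fun T => (measurable_price T).comp measurable_fst

/-- The expected revenue from a buyer with value distribution `D` when the items of `S` are offered
at prices `p`. -/
def revenueOn (D : Measure (Valuation m)) (S : Finset (Fin m)) (p : ItemPrices m) : ℝ≥0∞ :=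
  ∫⁻ v, price p (τ.alloc S p v) ∂D

theorem measurable_revenueOn (D : Measure (Valuation m)) [SFinite D] (S : Finset (Fin m)) :
    Measurable (revenueOn τ D S) :=
  (τ.measurable_price_alloc S).lintegral_prod_right'

end Revenue

namespace SeqItemPricing

variable {n m : ℕ} (M : SeqItemPricing n m) (τ : TieBreaking m)

section Dynamics

variable (ω : M.Seed) (v : Fin n → Valuation m)

/-- The bundle purchased by buyer `i`. -/
def purchase (i : Fin n) : Finset (Fin m) :=
  τ.alloc (M.available τ ω v i) (M.prices ω v i (M.available τ ω v i)) (v i)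

theorem available_succ (i : Fin n) :
    M.available τ ω v (i + 1) = M.available τ ω v i \ M.purchase τ ω v i :=
  dif_pos i.2

theorem available_succ_of_le {t : ℕ} (h : n ≤ t) :
    M.available τ ω v (t + 1) = M.available τ ω v t :=
  dif_neg h.not_gt

theorem available_antitone : Antitone (M.available τ ω v) := by
  refine antitone_nat_of_succ_le fun t => ?_
  by_cases h : t < n
  · exact (M.available_succ τ ω v ⟨t, h⟩).trans_le Finset.sdiff_subset
  · exact (M.available_succ_of_le τ ω v (not_lt.1 h)).le

theorem exists_mem_purchase_of_notMem_available {j : Fin m} {t : ℕ}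
    (h : j ∉ M.available τ ω v t) : ∃ i, j ∈ M.purchase τ ω v i := by
  induction t with
  | zero => exact absurd (Finset.mem_univ j) h
  | succ t ih =>
    by_cases ht : t < n
    · rw [M.available_succ τ ω v ⟨t, ht⟩, Finset.mem_sdiff, not_and_not_right] at h
      by_cases hj : j ∈ M.available τ ω v t
      · exact ⟨_, h hj⟩
      · exact ih hj
    · exact ih (M.available_succ_of_le τ ω v (not_lt.1 ht) ▸ h)

theorem sum_floor_sold_le_sum_payment {r : ItemPrices m} (hr : ∀ i S, r ≤ M.prices ω v i S) :
    ∑ j ∈ (M.available τ ω v n)ᶜ, r j ≤ ∑ i, M.payment τ ω v i := by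
  have hsold : (M.available τ ω v n)ᶜ ⊆ Finset.univ.biUnion (M.purchase τ ω v) := fun j hj => by
    simpa using M.exists_mem_purchase_of_notMem_available τ ω v (Finset.mem_compl.1 hj)
  calc ∑ j ∈ (M.available τ ω v n)ᶜ, r j
      ≤ ∑ j ∈ Finset.univ.biUnion (M.purchase τ ω v), r j := Finset.sum_le_sum_of_subset hsold
    _ ≤ ∑ i, price r (M.purchase τ ω v i) := price_biUnion_le r _ _
    _ ≤ ∑ i, M.payment τ ω v i :=
        Finset.sum_le_sum fun i _ => price_mono_prices (hr i _) _

variable {i : Fin n} (y : Valuation m)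

theorem prices_update {k : Fin n} (hk : k ≤ i) (S : Finset (Fin m)) :
    M.prices ω (Function.update v i y) k S = M.prices ω v k S := by
  unfold prices
  congr with l
  rw [Function.update_of_ne (l.2.trans_le hk).ne]

theorem available_update {t : ℕ} (ht : t ≤ i) :
    M.available τ ω (Function.update v i y) t = M.available τ ω v t := by
  induction t with
  | zero => rfl
  | succ t ih =>
    have htn : t < n := by omega
    have hti : ⟨t, htn⟩ < i := ht
    rw [M.available_succ τ ω v ⟨t, htn⟩, M.available_succ τ ω _ ⟨t, htn⟩, purchase, purchase,
      ih (by omega), M.prices_update ω v y hti.le, Function.update_of_ne hti.ne]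

end Dynamics

section Measurability

theorem measurable_prices (i : Fin n) (S : Finset (Fin m)) :
    Measurable fun z : M.Seed × (Fin n → Valuation m) => M.prices z.1 z.2 i S := by
  refine (M.measurable_offer i S).comp (measurable_fst.prodMk ?_)
  exact measurable_pi_lambda _ fun k => (measurable_pi_apply k.1).comp measurable_snd

theorem measurable_prices_prodMk_apply (i : Fin n) (S : Finset (Fin m)) :
    Measurable fun z : M.Seed × (Fin n → Valuation m) => (M.prices z.1 z.2 i S, z.2 i) :=
  (M.measurable_prices i S).prodMk ((measurable_pi_apply i).comp measurable_snd)

theorem measurable_available (t : ℕ) :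
    Measurable fun z : M.Seed × (Fin n → Valuation m) => M.available τ z.1 z.2 t := by
  induction t with
  | zero => exact measurable_const
  | succ t ih =>
    by_cases ht : t < n
    · simp only [M.available_succ τ _ _ ⟨t, ht⟩]
      exact measurable_comp_of_countable ih fun S => (Measurable.of_discrete (f := (S \ ·))).comp
        ((τ.measurable_alloc S).comp (M.measurable_prices_prodMk_apply ⟨t, ht⟩ S))
    · simpa only [M.available_succ_of_le τ _ _ (not_lt.1 ht)] using ih

theorem measurable_payment (i : Fin n) :
    Measurable fun z : M.Seed × (Fin n → Valuation m) => M.payment τ z.1 z.2 i :=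
  measurable_comp_of_countable (M.measurable_available τ i)
    fun S => (τ.measurable_price_alloc S).comp (M.measurable_prices_prodMk_apply i S)

theorem measurable_revenueOn_available (D : Measure (Valuation m)) [SFinite D] (i : Fin n) :
    Measurable fun z : M.Seed × (Fin n → Valuation m) =>
      revenueOn τ D (M.available τ z.1 z.2 i) (M.prices z.1 z.2 i (M.available τ z.1 z.2 i)) :=
  measurable_comp_of_countable (M.measurable_available τ i)
    fun S => (measurable_revenueOn τ D S).comp (M.measurable_prices i S)

end Measurability

variable (D : Fin n → Measure (Valuation m))

theorem rev_eq_sum_lintegral :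
    M.rev τ D =
      ∑ i, ∫⁻ z, M.payment τ z.1 z.2 i ∂(M.law : Measure M.Seed).prod (Measure.pi D) :=
  lintegral_finsetSum _ fun i _ => M.measurable_payment τ i

theorem rev_le_seqRev : M.rev τ D ≤ seqRev τ D :=
  le_iSup (fun M : SeqItemPricing n m => M.rev τ D) M

variable [∀ i, IsProbabilityMeasure (D i)]

theorem lintegral_payment (i : Fin n) :
    ∫⁻ z, M.payment τ z.1 z.2 i ∂(M.law : Measure M.Seed).prod (Measure.pi D) =
      ∫⁻ z, revenueOn τ (D i) (M.available τ z.1 z.2 i)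
        (M.prices z.1 z.2 i (M.available τ z.1 z.2 i))
        ∂(M.law : Measure M.Seed).prod (Measure.pi D) := by
  rw [lintegral_prod _ (M.measurable_payment τ i).aemeasurable,
    lintegral_prod _ (M.measurable_revenueOn_available τ (D i) i).aemeasurable]
  refine lintegral_congr fun ω => ?_
  have hpay : Measurable fun v => M.payment τ ω v i :=
    (M.measurable_payment τ i).comp measurable_prodMk_left
  rw [lintegral_pi_eq_lintegral_update D i hpay]
  simp only [payment, M.available_update τ ω _ _ le_rfl, Function.update_self,
    M.prices_update ω _ _ le_rfl, revenueOn]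

/-- Either many items are sold, and then the floors `r` on the prices guarantee the revenue, or a
buyer meets a large set of available items, from which it can be extracted. -/
theorem le_rev_of_floor {κ : ℝ≥0∞} {r : ItemPrices m} {t : Fin n → Finset (Fin m) → ℝ≥0∞}
    (ht : ∀ i, Monotone (t i)) (hr : ∀ ω v i S, r ≤ M.prices ω v i S)
    (hq : ∀ ω v i S, t i S ≤ κ * revenueOn τ (D i) S (M.prices ω v i S))
    {B : ℝ≥0∞} (hB : ∀ S, B ≤ κ * ∑ j ∈ Sᶜ, r j + ∑ i, t i S) : B ≤ 2 * κ * M.rev τ D := by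
  set ν := (M.law : Measure M.Seed).prod (Measure.pi D)
  have h_unsold (i : Fin n) : ∫⁻ z, t i (M.available τ z.1 z.2 n) ∂ν ≤
      κ * ∫⁻ z, M.payment τ z.1 z.2 i ∂ν := by
    rw [lintegral_payment, ← lintegral_const_mul κ (M.measurable_revenueOn_available τ (D i) i)]
    exact lintegral_mono fun z => (ht i (M.available_antitone τ z.1 z.2 i.2.le)).trans (hq _ _ i _)
  have h_floor (i : Fin n) :
      Measurable fun z : M.Seed × (Fin n → Valuation m) => t i (M.available τ z.1 z.2 n) :=
    Measurable.of_discrete.comp (M.measurable_available τ n)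
  have h_payments := Finset.measurable_fun_sum Finset.univ fun i _ => M.measurable_payment τ i
  calc B = ∫⁻ _, B ∂ν := by rw [lintegral_const, measure_univ, mul_one]
    _ ≤ ∫⁻ z, (κ * ∑ i, M.payment τ z.1 z.2 i + ∑ i, t i (M.available τ z.1 z.2 n)) ∂ν :=
        lintegral_mono fun z => (hB (M.available τ z.1 z.2 n)).trans <| by
          gcongr
          exact M.sum_floor_sold_le_sum_payment τ z.1 z.2 (hr _ _)
    _ = κ * M.rev τ D + ∑ i, ∫⁻ z, t i (M.available τ z.1 z.2 n) ∂ν := by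
        rw [lintegral_add_left (h_payments.const_mul κ), lintegral_const_mul κ h_payments,
          lintegral_finsetSum _ fun i _ => h_floor i, rev]
    _ ≤ κ * M.rev τ D + ∑ i, κ * ∫⁻ z, M.payment τ z.1 z.2 i ∂ν := by
        gcongr with i
        exact h_unsold i
    _ = 2 * κ * M.rev τ D := by
        rw [← Finset.mul_sum, ← rev_eq_sum_lintegral, mul_assoc, two_mul]

section Mixture

variable {ι : Type} [MeasurableSpace ι] [Countable ι] [MeasurableSingletonClass ι]

/-- The mechanism that draws an index `k` from `w` and then runs `M k`. Its seed consists of `k`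
and of independent seeds for all of the mechanisms `M l`, so that it lives in a product space. -/
def mixture (w : ProbabilityMeasure ι) (M : ι → SeqItemPricing n m) : SeqItemPricing n m where
  Seed := ι × ∀ k, (M k).Seed
  law := ⟨(w : Measure ι).prod (Measure.infinitePi fun k => ((M k).law : Measure (M k).Seed)),
    inferInstance⟩
  offer i ω v S := (M ω.1).offer i (ω.2 ω.1) v S
  measurable_offer i S := by
    have hseed (k : ι) : Measurable fun z : (ι × ∀ k, (M k).Seed) × (Set.Iio i → Valuation m) =>
        z.1.2 k :=
      (measurable_pi_apply k).comp (measurable_snd.comp measurable_fst)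
    exact measurable_comp_of_countable (measurable_fst.comp measurable_fst) fun k =>
      ((M k).measurable_offer i S).comp ((hseed k).prodMk measurable_snd)

variable (w : ProbabilityMeasure ι) (M : ι → SeqItemPricing n m)

theorem available_mixture (ω : (mixture w M).Seed) (v : Fin n → Valuation m) (t : ℕ) :
    (mixture w M).available τ ω v t = (M ω.1).available τ (ω.2 ω.1) v t := by
  induction t with
  | zero => rfl
  | succ t ih =>
    rw [available, available, ih]
    rfl

theorem payment_mixture (ω : (mixture w M).Seed) (v : Fin n → Valuation m) (i : Fin n) :
    (mixture w M).payment τ ω v i = (M ω.1).payment τ (ω.2 ω.1) v i := by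
  rw [payment, available_mixture]
  rfl

theorem rev_mixture : (mixture w M).rev τ D = ∫⁻ k, (M k).rev τ D ∂(w : Measure ι) := by
  have h_payments (k : ι) : Measurable fun z : (M k).Seed × (Fin n → Valuation m) =>
      ∑ i, (M k).payment τ z.1 z.2 i :=
    Finset.measurable_fun_sum _ fun i _ => (M k).measurable_payment τ i
  have h_rev (k : ι) : Measurable fun ω : (M k).Seed =>
      ∫⁻ v, ∑ i, (M k).payment τ ω v i ∂Measure.pi D := (h_payments k).lintegral_prod_right'
  have h_mixture : Measurable fun ω : (mixture w M).Seed =>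
      ∫⁻ v, ∑ i, (M ω.1).payment τ (ω.2 ω.1) v i ∂Measure.pi D :=
    measurable_comp_of_countable measurable_fst
      (f := fun k (ω : ι × ∀ k, (M k).Seed) =>
        ∫⁻ v, ∑ i, (M k).payment τ (ω.2 k) v i ∂Measure.pi D)
      fun k => (h_rev k).comp ((measurable_pi_apply k).comp measurable_snd)
  calc (mixture w M).rev τ D
      = ∫⁻ ω, ∫⁻ v, ∑ i, (mixture w M).payment τ ω v i ∂Measure.pi D
          ∂((mixture w M).law : Measure (mixture w M).Seed) :=
        lintegral_prod _ (Finset.measurable_fun_sum _ fun i _ =>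
          (mixture w M).measurable_payment τ i).aemeasurable
    _ = ∫⁻ k, ∫⁻ ω, ∫⁻ v, ∑ i, (M k).payment τ (ω k) v i ∂Measure.pi D
          ∂(Measure.infinitePi fun k => ((M k).law : Measure (M k).Seed)) ∂(w : Measure ι) := by
        simp only [payment_mixture]
        exact lintegral_prod _ h_mixture.aemeasurable
    _ = ∫⁻ k, (M k).rev τ D ∂(w : Measure ι) := lintegral_congr fun k => by
        rw [rev, lintegral_prod _ (h_payments k).aemeasurable]
        exact (measurePreserving_eval_infinitePi
          (fun k => ((M k).law : Measure (M k).Seed)) k).lintegral_comp (h_rev k)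

end Mixture

end SeqItemPricing

section PostedPrices

variable {n m : ℕ} (τ : TieBreaking m) (D : Fin n → Measure (Valuation m))

/-- The deterministic mechanism that offers the prices `q i S` to buyer `i` if the items of `S`
are available. -/
def postedPrices (q : Fin n → Finset (Fin m) → ItemPrices m) : SeqItemPricing n m where
  Seed := Unit
  law := ⟨Measure.dirac (), inferInstance⟩
  offer i _ _ S := q i S
  measurable_offer _ _ := measurable_const

variable [∀ i, IsProbabilityMeasure (D i)]

theorem revenue_le_seqRev (i : Fin n) (p : ItemPrices m) : revenue τ (D i) p ≤ seqRev τ D := by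
  set q : Fin n → Finset (Fin m) → ItemPrices m := fun k _ => if k = i then p else ⊤
  set M := postedPrices q
  have h_available (ω : M.Seed) (v : Fin n → Valuation m) {t : ℕ} (ht : t ≤ i) :
      M.available τ ω v t = Finset.univ := by
    induction t with
    | zero => rfl
    | succ t ih =>
      have htn : t < n := by omega
      have hti : (⟨t, htn⟩ : Fin n) ≠ i := ne_of_lt ht
      have h_purchase : M.purchase τ ω v ⟨t, htn⟩ = ∅ :=
        Finset.eq_empty_of_forall_notMem fun j =>
          (τ.isDemanded _ _ _).notMem_of_eq_top (congrFun (if_neg hti) j)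
      rw [M.available_succ τ ω v ⟨t, htn⟩, ih (by omega), h_purchase, Finset.sdiff_empty]
  have h_offer : q i Finset.univ = p := if_pos rfl
  set ν := (M.law : Measure M.Seed).prod (Measure.pi D)
  calc revenue τ (D i) p = ∫⁻ _, revenueOn τ (D i) Finset.univ (q i Finset.univ) ∂ν := by
        rw [lintegral_const, measure_univ, mul_one, h_offer]
        rfl
    _ = ∫⁻ z, M.payment τ z.1 z.2 i ∂ν := by
        rw [M.lintegral_payment]
        refine lintegral_congr fun z => ?_
        rw [h_available z.1 z.2 le_rfl]
        rfl
    _ ≤ ∑ i, ∫⁻ z, M.payment τ z.1 z.2 i ∂ν :=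
        Finset.single_le_sum (f := fun i => ∫⁻ z, M.payment τ z.1 z.2 i ∂ν)
          (fun _ _ => zero_le) (Finset.mem_univ i)
    _ = M.rev τ D := (M.rev_eq_sum_lintegral τ D).symm
    _ ≤ seqRev τ D := M.rev_le_seqRev τ D

theorem le_seqRev_of_floor {κ : ℝ≥0∞} (r : ItemPrices m) {t : Fin n → Finset (Fin m) → ℝ≥0∞}
    (ht : ∀ i, Monotone (t i)) (hq : ∀ i S, ∃ p, r ≤ p ∧ t i S ≤ κ * revenueOn τ (D i) S p)
    {B : ℝ≥0∞} (hB : ∀ S, B ≤ κ * ∑ j ∈ Sᶜ, r j + ∑ i, t i S) : B ≤ 2 * κ * seqRev τ D := by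
  choose q hr hq using hq
  calc B ≤ 2 * κ * (postedPrices q).rev τ D :=
        (postedPrices q).le_rev_of_floor τ D ht (fun _ _ => hr) (fun _ _ => hq) hB
    _ ≤ 2 * κ * seqRev τ D := by
        gcongr
        exact (postedPrices q).rev_le_seqRev τ D

theorem exists_rev_eq_top (h : seqRev τ D = ∞) : ∃ M : SeqItemPricing n m, M.rev τ D = ∞ := by
  -- Any law on `ℕ` that charges every point would do.
  set w : ProbabilityMeasure ℕ := ⟨ProbabilityTheory.poissonMeasure 1, inferInstance⟩
  have hw (k : ℕ) : (w : Measure ℕ) {k} ≠ 0 :=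
    (measureReal_ne_zero_iff (measure_ne_top _ _)).1
      (ProbabilityTheory.poissonMeasure_real_singleton_pos k one_pos).ne'
  have h_large (k : ℕ) : ∃ M : SeqItemPricing n m, ((w : Measure ℕ) {k})⁻¹ < M.rev τ D :=
    lt_iSup_iff.1 ((ENNReal.inv_lt_top.2 (pos_iff_ne_zero.2 (hw k))).trans_eq h.symm)
  choose M hM using h_large
  refine ⟨.mixture w M, top_le_iff.1 ?_⟩
  calc ∞ = ∑' _ : ℕ, (1 : ℝ≥0∞) := (ENNReal.tsum_const_eq_top_of_ne_zero one_ne_zero).symm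
    _ ≤ ∑' k, (M k).rev τ D * (w : Measure ℕ) {k} := by
        refine ENNReal.tsum_le_tsum fun k => ?_
        rw [← ENNReal.inv_mul_cancel (hw k) (measure_ne_top _ _)]
        gcongr
        exact (hM k).le
    _ = SeqItemPricing.rev (.mixture w M) τ D := by
        rw [SeqItemPricing.rev_mixture, lintegral_countable']

theorem exists_seqRev_le_two_mul_rev : ∃ M : SeqItemPricing n m, seqRev τ D ≤ 2 * M.rev τ D := by
  rcases eq_or_ne (seqRev τ D) ∞ with h_top | h_top
  · obtain ⟨M, hM⟩ := exists_rev_eq_top τ D h_top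
    exact ⟨M, by simp [hM]⟩
  rcases eq_or_ne (seqRev τ D) 0 with h_zero | h_zero
  · exact ⟨postedPrices fun _ _ => ⊤, by simp [h_zero]⟩
  · obtain ⟨M, hM⟩ := lt_iSup_iff.1 (ENNReal.half_lt_self h_zero h_top)
    exact ⟨M, by rw [mul_comm]; exact ENNReal.div_le_iff_le_mul (by simp) (by simp) |>.1 hM.le⟩

end PostedPrices

section Payments

variable {m : ℕ} (τ : TieBreaking m)

/-- The payment of a buyer, as a function of the offered prices and of the valuation, if it is at
least `c`, and zero otherwise. -/
def largePayment (c : ℝ≥0∞) (z : ItemPrices m × Valuation m) : ℝ≥0∞ :=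
  if c ≤ price z.1 (τ.alloc Finset.univ z.1 z.2) then price z.1 (τ.alloc Finset.univ z.1 z.2) else 0

/-- The payment of a buyer for item `j`, as a function of the offered prices and of the valuation,
if item `j` is bought at a price of at least `b` and the total payment is smaller than `c`, and zero
otherwise. -/
def smallPayment (c b : ℝ≥0∞) (j : Fin m) (z : ItemPrices m × Valuation m) : ℝ≥0∞ :=
  if j ∈ τ.alloc Finset.univ z.1 z.2 ∧ price z.1 (τ.alloc Finset.univ z.1 z.2) < c ∧ b ≤ z.1 j
  then z.1 j else 0

theorem measurable_largePayment (c : ℝ≥0∞) : Measurable (largePayment τ c) :=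
  (τ.measurable_price_alloc Finset.univ).ite
    (measurableSet_le measurable_const (τ.measurable_price_alloc Finset.univ)) measurable_const

theorem TieBreaking.measurableSet_mem_alloc (S : Finset (Fin m)) (j : Fin m) :
    MeasurableSet {z : ItemPrices m × Valuation m | j ∈ τ.alloc S z.1 z.2} :=
  τ.measurable_alloc S (MeasurableSet.of_discrete (s := {T | j ∈ T}))

theorem measurable_smallPayment (c b : ℝ≥0∞) (j : Fin m) : Measurable (smallPayment τ c b j) := by
  have h_price : Measurable fun z : ItemPrices m × Valuation m => z.1 j :=
    (measurable_pi_apply j).comp measurable_fst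
  exact h_price.ite ((τ.measurableSet_mem_alloc Finset.univ j).inter
    ((measurableSet_lt (τ.measurable_price_alloc Finset.univ) measurable_const).inter
      (measurableSet_le measurable_const h_price))) measurable_const

theorem largePayment_add_sum_smallPayment (c : ℝ≥0∞) (z : ItemPrices m × Valuation m) :
    largePayment τ c z + ∑ j, smallPayment τ c 0 j z =
      price z.1 (τ.alloc Finset.univ z.1 z.2) := by
  by_cases hc : c ≤ price z.1 (τ.alloc Finset.univ z.1 z.2)
  · simp [largePayment, smallPayment, hc, hc.not_gt]
  · simp only [largePayment, smallPayment, hc, not_le.1 hc, if_false, zero_add, zero_le, and_true,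
      Finset.sum_ite_mem, Finset.univ_inter]
    rfl

theorem smallPayment_antitone (c : ℝ≥0∞) (j : Fin m) (z : ItemPrices m × Valuation m) :
    Antitone fun b => smallPayment τ c b j z := by
  intro b b' hb
  by_cases hb' : b' ≤ z.1 j
  · simp [smallPayment, hb', hb.trans hb']
  · simp [smallPayment, hb']

theorem smallPayment_zero_le (c b : ℝ≥0∞) (j : Fin m) (z : ItemPrices m × Valuation m) :
    smallPayment τ c 0 j z ≤ smallPayment τ c b j z +
      {z : ItemPrices m × Valuation m | j ∈ τ.alloc Finset.univ z.1 z.2}.indicator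
        (fun _ => b) z := by
  unfold smallPayment
  by_cases hj : j ∈ τ.alloc Finset.univ z.1 z.2
  · rcases le_total b (z.1 j) with hb | hb
    · simp [hb]
    · simp only [hj, Set.indicator, Set.mem_ofPred_eq]
      split_ifs <;> simp_all
  · simp [hj]

variable (P : Measure (ItemPrices m)) (D : Measure (Valuation m)) [SFinite D]

theorem lintegral_revenue_eq (c : ℝ≥0∞) :
    ∫⁻ p, revenue τ D p ∂P = ∫⁻ z, largePayment τ c z ∂P.prod D +
      ∑ j, ∫⁻ z, smallPayment τ c 0 j z ∂P.prod D := by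
  rw [← lintegral_finsetSum _ fun j _ => measurable_smallPayment τ c 0 j,
    ← lintegral_add_left (measurable_largePayment τ c)]
  simp only [largePayment_add_sum_smallPayment]
  exact (lintegral_prod _ (τ.measurable_price_alloc Finset.univ).aemeasurable).symm

theorem lintegral_smallPayment_zero_le {P : ProbabilityMeasure (ItemPrices m)} {x : Fin m → ℝ≥0}
    (hP : SatisfiesExAnte τ D x P) (c b : ℝ≥0∞) (j : Fin m) :
    ∫⁻ z, smallPayment τ c 0 j z ∂(P : Measure (ItemPrices m)).prod D ≤
      ∫⁻ z, smallPayment τ c b j z ∂(P : Measure (ItemPrices m)).prod D + b * x j := by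
  have h_alloc := τ.measurableSet_mem_alloc Finset.univ j
  refine (lintegral_mono (smallPayment_zero_le τ c b j)).trans ?_
  rw [lintegral_add_left (measurable_smallPayment τ c b j), lintegral_indicator_const h_alloc,
    Measure.prod_apply h_alloc]
  gcongr
  exact hP j

theorem four_mul_price_half_add_const_le {p : ItemPrices m} {R : ℝ≥0∞} {T : Finset (Fin m)}
    (h : 4 * m * R ≤ price p T) :
    4 * price ((2⁻¹ : ℝ≥0∞) • p + fun _ => R) T ≤ 3 * price p T := by
  calc 4 * price ((2⁻¹ : ℝ≥0∞) • p + fun _ => R) T = 4 * (2⁻¹ * price p T + T.card * R) := by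
        simp only [price, Pi.add_apply, Pi.smul_apply, smul_eq_mul, Finset.sum_add_distrib,
          Finset.mul_sum, Finset.sum_const, nsmul_eq_mul]
    _ ≤ 4 * (2⁻¹ * price p T + m * R) := by
        gcongr
        simpa using Finset.card_le_univ T
    _ = 2 * price p T + 4 * m * R := by
        rw [mul_add, ← mul_assoc, ← mul_assoc, show (4 : ℝ≥0∞) = 2 * 2 by norm_num,
          mul_assoc 2 2 2⁻¹, ENNReal.mul_inv_cancel two_ne_zero ENNReal.ofNat_ne_top, mul_one]
    _ ≤ 2 * price p T + price p T := by gcongr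
    _ = 3 * price p T := by ring

/-- A price of `R` for every item is added to half of the prices that maximize the large payments.
By the law of demand, this does not lose more than a constant factor of a payment `≥ 4 m R`. -/
theorem exists_lintegral_largePayment_le [IsProbabilityMeasure P] {R : ℝ≥0∞}
    (hfin : ∫⁻ z, largePayment τ (4 * m * R) z ∂P.prod D ≠ ∞) :
    ∃ q, (fun _ => R) ≤ q ∧
      ∫⁻ z, largePayment τ (4 * m * R) z ∂P.prod D ≤ 4 * revenueOn τ D Finset.univ q := by
  obtain ⟨p, hp⟩ := exists_lintegral_prod_le (measurable_largePayment τ (4 * m * R)) hfin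
  set q : ItemPrices m := (2⁻¹ : ℝ≥0∞) • p + fun _ => R
  have hpq : p ≤ (2 : ℝ≥0∞) • q := fun j => by
    calc p j = 2 * (2⁻¹ * p j) := by
          rw [ENNReal.mul_inv_cancel_left two_ne_zero ENNReal.ofNat_ne_top]
      _ ≤ 2 * (2⁻¹ * p j + R) := by gcongr; exact le_self_add
  have h_price : Measurable fun v => price q (τ.alloc Finset.univ q v) :=
    (τ.measurable_price_alloc Finset.univ).comp measurable_prodMk_left
  refine ⟨q, fun j => le_add_self, hp.trans ?_⟩
  rw [revenueOn, ← lintegral_const_mul _ h_price]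
  refine lintegral_mono fun v => ?_
  rw [largePayment]
  split_ifs with h_large
  · exact (τ.isDemanded _ _ _).price_le_four_mul_price (τ.isDemanded _ _ _) hpq
      (four_mul_price_half_add_const_le h_large)
  · exact zero_le

theorem sum_smallPayment_le {v : Valuation m} (hv : IsSubadditive v) (p : ItemPrices m)
    (S : Finset (Fin m)) {c l : ℝ≥0∞} {b : ItemPrices m} {K : ℕ} (hl : ∀ j, l ≤ b j)
    (hK : c ≤ 2 ^ K * l) :
    ∑ j ∈ S, smallPayment τ c (b j) j (p, v) ≤
      2 * ∑ k ∈ Finset.range (K + 1), price (scaledPrices {j ∈ S | b j ≤ p j} p k)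
        (τ.alloc S (scaledPrices {j ∈ S | b j ≤ p j} p k) v) := by
  set T := τ.alloc Finset.univ p v
  by_cases hc : price p T < c
  · calc ∑ j ∈ S, smallPayment τ c (b j) j (p, v) = price p (T ∩ {j ∈ S | b j ≤ p j}) := by
          simp only [smallPayment, T, hc, true_and, ← Finset.sum_filter]
          refine Finset.sum_congr ?_ fun _ _ => rfl
          ext j
          simp [and_left_comm]
      _ ≤ _ := (τ.isDemanded Finset.univ p v).price_inter_le_sum_scaledPrices hv
          (Finset.filter_subset _ S) (fun j hj => (hl j).trans (Finset.mem_filter.1 hj).2)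
          (hc.le.trans hK) fun k => τ.isDemanded S _ v
  · have h_zero : ∀ j ∈ S, smallPayment τ c (b j) j (p, v) = 0 := fun j _ =>
      if_neg fun h => hc h.2.1
    rw [Finset.sum_eq_zero h_zero]
    exact zero_le

theorem exists_sum_lintegral_smallPayment_le [IsProbabilityMeasure P]
    (hD : ∀ᵐ v ∂D, IsSubadditive v) (S : Finset (Fin m)) {c l : ℝ≥0∞} {b : ItemPrices m} {K : ℕ}
    (hl : ∀ j, l ≤ b j) (hK : c ≤ 2 ^ K * l)
    (hfin : ∑ j ∈ S, ∫⁻ z, smallPayment τ c (b j) j z ∂P.prod D ≠ ∞) :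
    ∃ q, (2⁻¹ : ℝ≥0∞) • b ≤ q ∧
      ∑ j ∈ S, ∫⁻ z, smallPayment τ c (b j) j z ∂P.prod D ≤ 2 * (K + 1) * revenueOn τ D S q := by
  have h_small := fun j (_ : j ∈ S) => measurable_smallPayment τ c (b j) j
  rw [← lintegral_finsetSum S h_small] at hfin ⊢
  obtain ⟨p, hp⟩ := exists_lintegral_prod_le (Finset.measurable_fun_sum S h_small) hfin
  set q : ℕ → ItemPrices m := scaledPrices {j ∈ S | b j ≤ p j} p
  obtain ⟨k, -, hk⟩ := Finset.exists_max_image (Finset.range (K + 1))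
    (fun k => revenueOn τ D S (q k)) ⟨0, by simp⟩
  refine ⟨q k, fun j => ?_, hp.trans ?_⟩
  · by_cases hj : j ∈ ({j ∈ S | b j ≤ p j} : Finset (Fin m))
    · calc 2⁻¹ * b j ≤ 1 * 2⁻¹ * p j := by
            rw [one_mul]; gcongr; exact (Finset.mem_filter.1 hj).2
        _ ≤ 2 ^ k * 2⁻¹ * p j := by gcongr; exact one_le_pow₀ one_le_two
        _ = q k j := (if_pos hj).symm
    · exact le_top.trans_eq (if_neg hj).symm
  · have h_price (k : ℕ) : Measurable fun v => price (q k) (τ.alloc S (q k) v) :=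
      (τ.measurable_price_alloc S).comp measurable_prodMk_left
    calc ∫⁻ v, ∑ j ∈ S, smallPayment τ c (b j) j (p, v) ∂D
        ≤ ∫⁻ v, 2 * ∑ k ∈ Finset.range (K + 1), price (q k) (τ.alloc S (q k) v) ∂D :=
          lintegral_mono_ae (hD.mono fun v hv => sum_smallPayment_le τ hv p S hl hK)
      _ = 2 * ∑ k ∈ Finset.range (K + 1), revenueOn τ D S (q k) := by
          rw [lintegral_const_mul _ (Finset.measurable_fun_sum _ fun k _ => h_price k),
            lintegral_finsetSum _ fun k _ => h_price k]
          rfl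
      _ ≤ 2 * ((K + 1) * revenueOn τ D S (q k)) := by
          gcongr
          simpa using Finset.sum_le_card_nsmul _ _ _ hk
      _ = 2 * (K + 1) * revenueOn τ D S (q k) := (mul_assoc _ _ _).symm

end Payments

section Buyers

variable {n m : ℕ} (τ : TieBreaking m) (D : Fin n → Measure (Valuation m))

/-- The expected total of the payments of at least `c`, if each buyer is offered all items at random
prices with law `P i`. -/
def largeRevenue (P : Fin n → Measure (ItemPrices m)) (c : ℝ≥0∞) : ℝ≥0∞ :=
  ∑ i, ∫⁻ z, largePayment τ c z ∂(P i).prod (D i)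

/-- The expected total of what the buyers whose payment is smaller than `c` pay for item `j` at
prices of at least `b`, if each buyer is offered all items at random prices with law `P i`. -/
def smallRevenue (P : Fin n → Measure (ItemPrices m)) (c b : ℝ≥0∞) (j : Fin m) : ℝ≥0∞ :=
  ∑ i, ∫⁻ z, smallPayment τ c b j z ∂(P i).prod (D i)

theorem smallRevenue_antitone (P : Fin n → Measure (ItemPrices m)) (c : ℝ≥0∞) (j : Fin m) :
    Antitone fun b => smallRevenue τ D P c b j := fun _ _ hb =>
  Finset.sum_le_sum fun _ _ => lintegral_mono fun z => smallPayment_antitone τ c j z hb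

section

variable [∀ i, SFinite (D i)]

theorem sum_lintegral_revenue_eq (P : Fin n → Measure (ItemPrices m)) (c : ℝ≥0∞) :
    ∑ i, ∫⁻ p, revenue τ (D i) p ∂P i =
      largeRevenue τ D P c + ∑ j, smallRevenue τ D P c 0 j := by
  simp only [lintegral_revenue_eq τ _ _ c, Finset.sum_add_distrib, largeRevenue, smallRevenue]
  rw [Finset.sum_comm (s := Finset.univ (α := Fin n))]

theorem smallRevenue_zero_le {P : Fin n → ProbabilityMeasure (ItemPrices m)}
    {x : Fin n → Fin m → ℝ≥0} (hP : ∀ i, SatisfiesExAnte τ (D i) (x i) (P i))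
    (hx : ∀ j, ∑ i, x i j ≤ 1) (c b : ℝ≥0∞) (j : Fin m) :
    smallRevenue τ D (fun i => P i) c 0 j ≤ smallRevenue τ D (fun i => P i) c b j + b := by
  calc smallRevenue τ D (fun i => P i) c 0 j
      ≤ ∑ i, (∫⁻ z, smallPayment τ c b j z ∂(P i : Measure (ItemPrices m)).prod (D i) +
          b * x i j) :=
        Finset.sum_le_sum fun i _ => lintegral_smallPayment_zero_le τ (D i) (hP i) c b j
    _ = smallRevenue τ D (fun i => P i) c b j + b * ∑ i, (x i j : ℝ≥0∞) := by
        rw [Finset.sum_add_distrib, Finset.mul_sum, smallRevenue]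
    _ ≤ smallRevenue τ D (fun i => P i) c b j + b * 1 := by
        gcongr
        exact_mod_cast hx j
    _ = _ := by rw [mul_one]

end

variable [∀ i, IsProbabilityMeasure (D i)]

section

variable (P : Fin n → Measure (ItemPrices m)) [∀ i, IsProbabilityMeasure (P i)]

theorem largeRevenue_le {R : ℝ≥0∞} (hR : R ≠ ∞)
    (h : largeRevenue τ D P (4 * m * R) ≤ R) :
    largeRevenue τ D P (4 * m * R) ≤ 8 * seqRev τ D := by
  set H : Fin n → ℝ≥0∞ := fun i => ∫⁻ z, largePayment τ (4 * m * R) z ∂(P i).prod (D i)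
  have hH (i : Fin n) : H i ≠ ∞ := ne_top_of_le_ne_top hR <|
    (Finset.single_le_sum (fun _ _ => zero_le) (Finset.mem_univ i)).trans h
  set t : Fin n → Finset (Fin m) → ℝ≥0∞ := fun i S => if S = Finset.univ then H i else 0
  have ht (i : Fin n) : Monotone (t i) := fun S S' hS => by
    by_cases h_univ : S = Finset.univ
    · subst h_univ
      rw [Finset.univ_subset_iff.1 hS]
    · simp [t, h_univ]
  have hq (i : Fin n) (S : Finset (Fin m)) :
      ∃ q : ItemPrices m, (fun _ => R) ≤ q ∧ t i S ≤ 4 * revenueOn τ (D i) S q := by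
    by_cases h_univ : S = Finset.univ
    · simpa [t, h_univ] using exists_lintegral_largePayment_le τ (P i) (D i) (hH i)
    · exact ⟨fun _ => R, le_rfl, by simp [t, h_univ]⟩
  refine (le_seqRev_of_floor τ D (κ := 4) (fun _ => R) ht hq fun S => ?_).trans_eq (by norm_num)
  by_cases h_univ : S = Finset.univ
  · simp [t, h_univ, largeRevenue, H]
  · obtain ⟨j, hj⟩ := Finset.nonempty_iff_ne_empty.2 (h_univ ∘ (Finset.compl_eq_empty_iff S).1)
    calc largeRevenue τ D P (4 * m * R) ≤ 1 * R := by rwa [one_mul]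
      _ ≤ 4 * ∑ _ ∈ Sᶜ, R := by
          gcongr
          · norm_num
          · exact Finset.single_le_sum (f := fun _ => R) (fun _ _ => zero_le) hj
      _ ≤ 4 * ∑ _ ∈ Sᶜ, R + ∑ i, t i S := le_self_add

theorem sum_smallRevenue_le (hD : ∀ i, ∀ᵐ v ∂D i, IsSubadditive v) {c l : ℝ≥0∞}
    {b : ItemPrices m} {K : ℕ} (hl : ∀ j, l ≤ b j) (hK : c ≤ 2 ^ K * l) (hb : ∀ j, b j ≠ ∞)
    (h : ∀ j, smallRevenue τ D P c (b j) j ≤ 4 * b j) :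
    ∑ j, smallRevenue τ D P c (b j) j ≤ 16 * (K + 1) * seqRev τ D := by
  set W : Fin n → Fin m → ℝ≥0∞ := fun i j => ∫⁻ z, smallPayment τ c (b j) j z ∂(P i).prod (D i)
  have hW (i : Fin n) (j : Fin m) : W i j ≠ ∞ :=
    ne_top_of_le_ne_top (ENNReal.mul_ne_top ENNReal.ofNat_ne_top (hb j)) <|
      (Finset.single_le_sum (f := fun i => W i j) (fun _ _ => zero_le) (Finset.mem_univ i)).trans
        (h j)
  have hq (i : Fin n) (S : Finset (Fin m)) : ∃ q : ItemPrices m, (2⁻¹ : ℝ≥0∞) • b ≤ q ∧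
      ∑ j ∈ S, W i j ≤ 8 * (K + 1) * revenueOn τ (D i) S q := by
    obtain ⟨q, hq, h_rev⟩ := exists_sum_lintegral_smallPayment_le τ (P i) (D i) (hD i) S hl hK
      (ENNReal.sum_ne_top.2 fun j _ => hW i j)
    refine ⟨q, hq, h_rev.trans ?_⟩
    gcongr
    norm_num
  have ht (i : Fin n) : Monotone fun S => ∑ j ∈ S, W i j := fun _ _ => Finset.sum_le_sum_of_subset
  refine (le_seqRev_of_floor τ D (κ := 8 * (K + 1)) ((2⁻¹ : ℝ≥0∞) • b) ht hq fun S => ?_).trans_eq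
    (by ring)
  calc ∑ j, smallRevenue τ D P c (b j) j
      = ∑ j ∈ Sᶜ, smallRevenue τ D P c (b j) j + ∑ i, ∑ j ∈ S, W i j := by
        rw [Finset.sum_comm (t := S)]
        exact (Finset.sum_compl_add_sum S _).symm
    _ ≤ 8 * (K + 1) * ∑ j ∈ Sᶜ, ((2⁻¹ : ℝ≥0∞) • b) j + ∑ i, ∑ j ∈ S, W i j := by
        gcongr
        rw [Finset.mul_sum]
        refine Finset.sum_le_sum fun j _ => (h j).trans ?_
        calc 4 * b j = 8 * 1 * (2⁻¹ * b j) := by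
              rw [mul_one, show (8 : ℝ≥0∞) = 4 * 2 by norm_num, mul_assoc,
                ENNReal.mul_inv_cancel_left two_ne_zero ENNReal.ofNat_ne_top]
          _ ≤ 8 * (K + 1) * (2⁻¹ * b j) := by gcongr; exact le_add_self

end

variable {P : Fin n → ProbabilityMeasure (ItemPrices m)} {x : Fin n → Fin m → ℝ≥0}

theorem sum_smallRevenue_zero_le (hD : ∀ i, ∀ᵐ v ∂D i, IsSubadditive v) (hm : m ≠ 0) {K : ℕ}
    (hK : 16 * m ^ 2 ≤ 2 ^ K) (hP : ∀ i, SatisfiesExAnte τ (D i) (x i) (P i))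
    (hx : ∀ j, ∑ i, x i j ≤ 1) {R : ℝ≥0∞} (hR : R ≠ ∞)
    (h : ∑ j, smallRevenue τ D (fun i => P i) (4 * m * R) 0 j ≤ R) :
    ∑ j, smallRevenue τ D (fun i => P i) (4 * m * R) 0 j ≤
      16 * (K + 1) * seqRev τ D + R / 2 := by
  set V : ℝ≥0∞ → Fin m → ℝ≥0∞ := smallRevenue τ D (fun i => P i) (4 * m * R)
  -- Item `j` can sustain the price `V 0 j / 4`; the share `l` of `R` is added to it in order that
  -- all floors on the prices are within a factor `2 ^ K` of the threshold `4 * m * R`.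
  set l : ℝ≥0∞ := (4 * (m : ℝ≥0∞))⁻¹ * R
  set b : ItemPrices m := fun j => 4⁻¹ * V 0 j + l
  have hl : 4 * m * l = R := ENNReal.mul_inv_cancel_left (by simp [hm]) (by finiteness)
  have hV (j : Fin m) : V (b j) j ≤ 4 * b j := by
    calc V (b j) j ≤ V 0 j := smallRevenue_antitone τ D _ _ j zero_le
      _ = 4 * (4⁻¹ * V 0 j) :=
          (ENNReal.mul_inv_cancel_left four_ne_zero ENNReal.ofNat_ne_top).symm
      _ ≤ 4 * b j := by gcongr; exact le_self_add
  have hb_sum : ∑ j, b j ≤ R / 2 := by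
    have hml : m * l = 4⁻¹ * R := by
      rw [← hl, mul_assoc, ENNReal.inv_mul_cancel_left four_ne_zero ENNReal.ofNat_ne_top]
    calc ∑ j, b j = 4⁻¹ * ∑ j, V 0 j + m * l := by
          simp [b, Finset.sum_add_distrib, Finset.mul_sum]
      _ ≤ 4⁻¹ * R + 4⁻¹ * R := by rw [hml]; gcongr
      _ = 2⁻¹ * (2⁻¹ * R + 2⁻¹ * R) := by
          rw [show (4 : ℝ≥0∞) = 2 * 2 by norm_num, ENNReal.mul_inv (by simp) (by simp)]
          ring
      _ = R / 2 := by
          rw [← add_mul, ENNReal.inv_two_add_inv_two, one_mul, mul_comm, div_eq_mul_inv]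
  have hb (j : Fin m) : b j ≠ ∞ :=
    ENNReal.sum_ne_top.1 (ne_top_of_le_ne_top (by finiteness) hb_sum) j (Finset.mem_univ j)
  have hc : 4 * m * R ≤ 2 ^ K * l := by
    calc 4 * m * R = (16 * m ^ 2 : ℕ) * l := by rw [← hl]; push_cast; ring
      _ ≤ (2 ^ K : ℕ) * l := by gcongr
      _ = 2 ^ K * l := by push_cast; rfl
  calc ∑ j, V 0 j ≤ ∑ j, (V (b j) j + b j) :=
        Finset.sum_le_sum fun j _ => smallRevenue_zero_le τ D hP hx _ _ j
    _ = ∑ j, V (b j) j + ∑ j, b j := Finset.sum_add_distrib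
    _ ≤ 16 * (K + 1) * seqRev τ D + R / 2 := by
        gcongr
        exact sum_smallRevenue_le τ D _ hD (fun j => le_add_self) hc hb hV

theorem sum_lintegral_revenue_le (hD : ∀ i, ∀ᵐ v ∂D i, IsSubadditive v) (hm : m ≠ 0) {K : ℕ}
    (hK : 16 * m ^ 2 ≤ 2 ^ K) (hP : ∀ i, SatisfiesExAnte τ (D i) (x i) (P i))
    (hx : ∀ j, ∑ i, x i j ≤ 1) :
    ∑ i, ∫⁻ p, revenue τ (D i) p ∂(P i : Measure (ItemPrices m)) ≤
      48 * (K + 1) * seqRev τ D := by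
  rcases eq_or_ne (seqRev τ D) ∞ with h_top | h_top
  · rw [h_top, ENNReal.mul_top (by simp)]
    exact le_top
  set R : ℝ≥0∞ := ∑ i, ∫⁻ p, revenue τ (D i) p ∂(P i : Measure (ItemPrices m))
  have hR : R ≠ ∞ := ENNReal.sum_ne_top.2 fun i _ => ne_top_of_le_ne_top h_top <|
    calc ∫⁻ p, revenue τ (D i) p ∂(P i : Measure (ItemPrices m))
        ≤ ∫⁻ _, seqRev τ D ∂(P i : Measure (ItemPrices m)) :=
          lintegral_mono fun p => revenue_le_seqRev τ D i p
      _ = seqRev τ D := by simp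
  have h_split := sum_lintegral_revenue_eq τ D (fun i => (P i : Measure _)) (4 * m * R)
  have h_large := largeRevenue_le τ D _ hR (le_self_add.trans_eq h_split.symm)
  have h_small := sum_smallRevenue_zero_le τ D hD hm hK hP hx hR
    (le_add_self.trans_eq h_split.symm)
  have h_half : R / 2 ≤ 24 * (K + 1) * seqRev τ D := by
    rw [← ENNReal.add_le_add_iff_right (by finiteness : R / 2 ≠ ∞)]
    calc R / 2 + R / 2 = R := ENNReal.add_halves R
      _ ≤ 8 * seqRev τ D + (16 * (K + 1) * seqRev τ D + R / 2) :=
          h_split.trans_le (add_le_add h_large h_small)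
      _ = (8 * 1 + 16 * (K + 1)) * seqRev τ D + R / 2 := by ring
      _ ≤ (8 * (K + 1) + 16 * (K + 1)) * seqRev τ D + R / 2 := by gcongr; exact le_add_self
      _ = 24 * (K + 1) * seqRev τ D + R / 2 := by ring
  calc R = R / 2 + R / 2 := (ENNReal.add_halves R).symm
    _ ≤ 24 * (K + 1) * seqRev τ D + 24 * (K + 1) * seqRev τ D := add_le_add h_half h_half
    _ = 48 * (K + 1) * seqRev τ D := by ring

theorem EARev_le (hD : ∀ i, ∀ᵐ v ∂D i, IsSubadditive v) (hm : m ≠ 0) {K : ℕ}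
    (hK : 16 * m ^ 2 ≤ 2 ^ K) : EARev τ D ≤ 48 * (K + 1) * seqRev τ D := by
  refine iSup₂_le fun x hx => ?_
  have (i : Fin n) : Nonempty {P // SatisfiesExAnte τ (D i) (x i) P} := by
    refine ⟨⟨Measure.dirac ⊤, inferInstance⟩, fun j => ?_⟩
    have h_none (v : Valuation m) : j ∉ τ.alloc Finset.univ ⊤ v :=
      (τ.isDemanded _ _ _).notMem_of_eq_top rfl
    simp [allocProb, h_none]
  simp only [exAnteRevBuyer, iSup_subtype']
  exact sum_iSup_le fun P => sum_lintegral_revenue_le τ D hD hm hK (fun i => (P i).2) hx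

end Buyers

theorem EARev_eq_zero_of_no_items {n : ℕ} (τ : TieBreaking 0)
    (D : Fin n → Measure (Valuation 0)) : EARev τ D = 0 := by
  simp [EARev, exAnteRevBuyer, revenue, price, Finset.eq_empty_of_isEmpty]

theorem two_mul_natLog_add_seven_le {m : ℕ} (hm : m ≠ 0) :
    (2 * Nat.log 2 m + 7 : ℝ) ≤ 14 * Real.log (m + 1) := by
  have hm_one : (1 : ℝ) ≤ m := by exact_mod_cast Nat.one_le_iff_ne_zero.2 hm
  have h_natLog : Nat.log 2 m * Real.log 2 ≤ Real.log (m + 1) := by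
    calc Nat.log 2 m * Real.log 2 ≤ Real.logb 2 m * Real.log 2 := by
          gcongr
          exact_mod_cast Real.natLog_le_logb m 2
      _ = Real.log m := div_mul_cancel₀ _ (by positivity)
      _ ≤ Real.log (m + 1) := by gcongr; linarith
  have h_two : Real.log 2 ≤ Real.log (m + 1) := by gcongr; linarith
  nlinarith [Real.log_two_gt_d9, (Nat.cast_nonneg _ : (0 : ℝ) ≤ Nat.log 2 m)]

theorem EARev_le_mul_log {n m : ℕ} (τ : TieBreaking m) (D : Fin n → Measure (Valuation m))
    [∀ i, IsProbabilityMeasure (D i)] (hD : ∀ i, ∀ᵐ v ∂D i, IsSubadditive v) :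
    EARev τ D ≤ ENNReal.ofReal (672 * Real.log (m + 1)) * seqRev τ D := by
  rcases eq_or_ne m 0 with rfl | hm
  · rw [EARev_eq_zero_of_no_items]
    exact zero_le
  have hK : 16 * m ^ 2 ≤ 2 ^ (2 * Nat.log 2 m + 6) := by
    have hm_lt : m < 2 ^ (Nat.log 2 m + 1) := Nat.lt_pow_succ_log_self one_lt_two m
    calc 16 * m ^ 2 ≤ 16 * (2 ^ (Nat.log 2 m + 1)) ^ 2 := by gcongr
      _ = 2 ^ (2 * Nat.log 2 m + 6) := by ring
  refine (EARev_le τ D hD hm hK).trans ?_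
  gcongr
  have h_log : (48 * (2 * Nat.log 2 m + 7) : ℝ) ≤ 672 * Real.log (m + 1) := by
    linarith [two_mul_natLog_add_seven_le hm]
  calc (48 * ((2 * Nat.log 2 m + 6 : ℕ) + 1) : ℝ≥0∞) = (48 * (2 * Nat.log 2 m + 7) : ℕ) := by
        push_cast
        ring
    _ ≤ ENNReal.ofReal (672 * Real.log (m + 1)) :=
        (ENNReal.natCast_le_ofReal (by positivity)).2 (mod_cast h_log)

end Pricing

end

theorem theorem1 :
    ∃ C : ℝ, 0 < C ∧
      ∀ (n m : ℕ) (τ : Pricing.TieBreaking m)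
        (D : Fin n → MeasureTheory.Measure (Pricing.Valuation m))
        [∀ i, MeasureTheory.IsProbabilityMeasure (D i)],
        (∀ i, ∀ᵐ v ∂(D i), Pricing.IsSubadditive v) →
          Pricing.EARev τ D ≤ ENNReal.ofReal (C * Real.log (m + 1)) * Pricing.seqRev τ D ∧
          ∃ M : Pricing.SeqItemPricing n m,
            Pricing.EARev τ D ≤ ENNReal.ofReal (C * Real.log (m + 1)) * M.rev τ D := by
  refine ⟨2 * 672, by norm_num, fun n m τ D _ hD => ?_⟩
  have h_bound := Pricing.EARev_le_mul_log τ D hD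
  obtain ⟨M, hM⟩ := Pricing.exists_seqRev_le_two_mul_rev τ D
  have h_log : 0 ≤ Real.log (m + 1) := Real.log_nonneg (by simp)
  refine ⟨h_bound.trans ?_, M, ?_⟩
  · gcongr
    norm_num
  · calc Pricing.EARev τ D
        ≤ ENNReal.ofReal (672 * Real.log (m + 1)) * (2 * M.rev τ D) := by grw [h_bound, hM]
      _ = ENNReal.ofReal (2 * 672 * Real.log (m + 1)) * M.rev τ D := by
        rw [mul_assoc 2, ENNReal.ofReal_mul zero_le_two, ENNReal.ofReal_ofNat]
        ring
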